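/- Let $R$ be a Gorenstein local ring (a commutative Noetherian local ring of finite injective dimension as a module over itself) of Krull dimension one, and let $I=(a,b)$ be an ideal of $R$ generated by two regular elements (non-zero-divisors) $a$ and $b$. Then $I$ is rigid, that is, $\operatorname{Ext}^1_R(I,I)=0$, if and only if \[ ((a):b)\cap((b):a)=((a):b)\cdot((b):a), \] where $((x):y)=\{r\in R : ry\in (x)\}$. -/

import Mathlib

universe u

open CategoryTheory Abelian

/-- A commutative ring is a Gorenstein local ring if it is Noetherian, local and of finite injective
dimension as a module over itself. -/
class IsGorensteinLocalRing (R : Type u) [CommRing R] : Prop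
    extends IsNoetherianRing R, IsLocalRing R where
  exists_hasInjectiveDimensionLE : ∃ n : ℕ, HasInjectiveDimensionLE (ModuleCat.of R R) n

/-- An `R`-module `M` is rigid if `Ext¹_R(M, M) = 0`. -/
def IsRigidModule (R : Type u) [CommRing R] (M : Type u) [AddCommGroup M] [Module R M] : Prop :=
  Subsingleton (Ext (ModuleCat.of R M) (ModuleCat.of R M) 1)

/-!
Put `I = (a, b)`, `K = (b) : a` and `L = (a) : b`. As `b` is regular, a homomorphism from the module
of relations between `a` and `b` to `I` is determined by the image `c` of the relation `(b, -a)`.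
The possible values of `c` form the ideal `bI : K`, and the homomorphism extends to `R²` if and only
if `c ∈ I²`; hence `I` is rigid if and only if `I² = bI : K`.

In a Gorenstein ring of dimension at most one, `(x) : ((x) : J) = J` for every regular `x ∈ J`,
because `R ⧸ xR` cogenerates the finite modules killed by `x`. So `bI : K = (b²) : K²`, and
`I² = (b²) : K²` is equivalent to `K² = (b²) : I²`. As `aK = bL` and
`a((b²) : I²) = b(L ∩ K)`, multiplying `K² = (b²) : I²` by `a` gives the equivalent equality
`bLK = b(L ∩ K)`, from which `b` cancels.
-/

section ExtGroups

universe w v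

variable {C : Type v} [Category C] [Abelian C] [HasExt.{w} C] {S : ShortComplex C} {Y : C}

theorem subsingleton_ext_X₁ (hS : S.ShortExact) {n : ℕ} (h₂ : Subsingleton (Ext S.X₂ Y n))
    (h₃ : Subsingleton (Ext S.X₃ Y (1 + n))) : Subsingleton (Ext S.X₁ Y n) := by
  refine subsingleton_of_forall_eq 0 fun e => ?_
  obtain ⟨e', rfl⟩ := Ext.contravariant_sequence_exact₁ hS Y e rfl (Subsingleton.elim _ _)
  rw [Subsingleton.elim e' 0, Ext.comp_zero]

theorem subsingleton_ext_X₂ (hS : S.ShortExact) {n : ℕ} (h₁ : Subsingleton (Ext S.X₁ Y n))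
    (h₃ : Subsingleton (Ext S.X₃ Y n)) : Subsingleton (Ext S.X₂ Y n) := by
  refine subsingleton_of_forall_eq 0 fun e => ?_
  obtain ⟨e', rfl⟩ := Ext.contravariant_sequence_exact₂ hS Y e (Subsingleton.elim _ _)
  rw [Subsingleton.elim e' 0, Ext.comp_zero]

theorem subsingleton_ext_one_iff_forall_exists_comp_eq (hS : S.ShortExact) [Projective S.X₂] :
    Subsingleton (Ext S.X₃ Y 1) ↔ ∀ f : S.X₁ ⟶ Y, ∃ g : S.X₂ ⟶ Y, S.f ≫ g = f := by
  refine ⟨fun h f => ?_, fun h => subsingleton_of_forall_eq 0 fun e => ?_⟩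
  · obtain ⟨g', hg⟩ := Ext.contravariant_sequence_exact₁ hS Y (Ext.mk₀ f) (add_zero 1)
      (Subsingleton.elim _ _)
    obtain ⟨g, rfl⟩ := (Ext.mk₀_bijective _ _).surjective g'
    exact ⟨g, (Ext.mk₀_bijective _ _).injective (by rw [← hg, Ext.mk₀_comp_mk₀])⟩
  · obtain ⟨f', rfl⟩ := Ext.contravariant_sequence_exact₃ hS Y e
      (Ext.eq_zero_of_projective _) (add_zero 1)
    obtain ⟨f, rfl⟩ := (Ext.mk₀_bijective _ _).surjective f'
    obtain ⟨g, rfl⟩ := h f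
    rw [← Ext.mk₀_comp_mk₀, hS.extClass_comp_assoc]

theorem bijective_mk₀_comp_extClass (hS : S.ShortExact) (hY : Subsingleton (Y ⟶ S.X₂))
    (hExt : ∀ e : Ext Y S.X₁ 1, e.comp (Ext.mk₀ S.f) (add_zero 1) = 0) :
    Function.Bijective fun f : Y ⟶ S.X₃ => (Ext.mk₀ f).comp hS.extClass (zero_add 1) := by
  refine ⟨fun f g hfg => sub_eq_zero.1 ((Ext.mk₀_eq_zero_iff _).1 ?_), fun e => ?_⟩
  · have hsub : (Ext.mk₀ (f - g)).comp hS.extClass (zero_add 1) = 0 := by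
      rw [sub_eq_add_neg, Ext.mk₀_add, Ext.mk₀_neg, Ext.add_comp, Ext.neg_comp, ← sub_eq_add_neg]
      exact sub_eq_zero.2 hfg
    obtain ⟨h', hh'⟩ := Ext.covariant_sequence_exact₃ Y hS (Ext.mk₀ (f - g)) (zero_add 1) hsub
    obtain ⟨h, rfl⟩ := (Ext.mk₀_bijective _ _).surjective h'
    rw [← hh', Subsingleton.elim h 0, Ext.mk₀_zero, Ext.zero_comp]
  · obtain ⟨f', hf'⟩ := Ext.covariant_sequence_exact₁ Y hS e (hExt e) (zero_add 1)
    obtain ⟨f, rfl⟩ := (Ext.mk₀_bijective _ _).surjective f'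
    exact ⟨f, hf'⟩

end ExtGroups

section Duality

open scoped Pointwise

variable {R : Type u} [CommRing R] {x : R} {N : ModuleCat.{u} R}

theorem smul_top_eq_span_singleton (x : R) : x • (⊤ : Ideal R) = Ideal.span {x} := by
  rw [← Submodule.ideal_span_singleton_smul, smul_eq_mul, Ideal.mul_top]

theorem exists_injective_quotient_quotSMulTop [IsNoetherianRing R] [Ring.KrullDimLE 1 R]
    (hx : IsRegular x) {p : Ideal R} [p.IsPrime] (hxp : x ∈ p) :
    ∃ f : (R ⧸ p) →ₗ[R] QuotSMulTop x R, Function.Injective f := by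
  have hann : Module.annihilator R (QuotSMulTop x R) = Ideal.span {x} :=
    (Ideal.annihilator_quotient (I := x • ⊤)).trans (smul_top_eq_span_singleton x)
  have hmin : p ∈ (Module.annihilator R (QuotSMulTop x R)).minimalPrimes := by
    rw [hann]
    refine ⟨⟨‹_›, (Ideal.span_singleton_le_iff_mem _).2 hxp⟩, fun q ⟨hq, hxq⟩ hqp => ?_⟩
    have hq_max : q.IsMaximal := (Ring.krullDimLE_one_iff.1 ‹_› q hq).resolve_left
      (notMem_nonZeroDivisors_of_mem_mem_minimalPrimes
        ((Ideal.span_singleton_le_iff_mem _).1 hxq) · hx.mem_nonZeroDivisors)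
    exact (hq_max.eq_of_le ‹p.IsPrime›.ne_top hqp).ge
  exact ((isAssociatedPrime_iff_exists_injective_linearMap _ _).1
    (Module.associatedPrimes.minimalPrimes_annihilator_subset_associatedPrimes R _ hmin)).2

theorem subsingleton_ext_quotSMulTop (hx : IsRegular x) {n : ℕ} (hn : 2 ≤ n) :
    Subsingleton (Ext (ModuleCat.of R (QuotSMulTop x R)) N n) := by
  have hS := IsSMulRegular.smulShortComplex_shortExact (M := ModuleCat.of R R) hx.left
  have hR : HasProjectiveDimensionLT (ModuleCat.of R R) 1 :=
    projective_iff_hasProjectiveDimensionLT_one.1 inferInstance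
  have := hS.hasProjectiveDimensionLT_X₃ 1 hR
    (hasProjectiveDimensionLT_of_ge (ModuleCat.of R R) 1 2 one_le_two)
  exact HasProjectiveDimensionLT.subsingleton ((ModuleCat.of R R).smulShortComplex x).X₃ 2 n hn N

/- Descending induction on `n`: a prime containing `x` has its residue ring embedded in `R ⧸ xR`,
whose cokernel is again killed by `x`, and `Extⁿ(R ⧸ xR, N) = 0`. -/
theorem subsingleton_ext_of_mem_annihilator [IsNoetherianRing R] [Ring.KrullDimLE 1 R]
    (d : ℕ) [HasInjectiveDimensionLT N d] (hx : IsRegular x) {n : ℕ} (hn : 2 ≤ n)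
    (M : Type u) [AddCommGroup M] [Module R M] [hfin : Module.Finite R M]
    (hM : x ∈ Module.annihilator R M) : Subsingleton (Ext (ModuleCat.of R M) N n) := by
  obtain hdn | hnd := le_total d n
  · exact HasInjectiveDimensionLT.subsingleton N d n hdn _
  induction hnd using Nat.decreasingInduction generalizing M with
  | self => exact HasInjectiveDimensionLT.subsingleton N d d le_rfl _
  | of_succ n _ ih =>
    induction hfin using IsNoetherianRing.induction_on_isQuotientEquivQuotientPrime R with
    | subsingleton M =>
      have := (ModuleCat.isZero_of_subsingleton (.of R M)).hasProjectiveDimensionLT_zero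
      exact HasProjectiveDimensionLT.subsingleton (ModuleCat.of R M) 0 n n.zero_le N
    | quotient M p e =>
      rw [e.annihilator_eq, Ideal.annihilator_quotient] at hM
      obtain ⟨f, hf⟩ := exists_injective_quotient_quotSMulTop hx hM
      have hfg := (f ∘ₗ e.toLinearMap).exact_map_mkQ_range
      have hcoker := ih (by lia) _ (LinearMap.annihilator_le_of_surjective _
        (Submodule.mkQ_surjective (f ∘ₗ e.toLinearMap).range) (QuotSMulTop.mem_annihilator R x))
      exact subsingleton_ext_X₁ (ModuleCat.shortComplex_shortExact
        (ModuleCat.shortComplexOfCompEqZero _ _ hfg.linearMap_comp_eq_zero)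
        hfg (hf.comp e.injective) (Submodule.mkQ_surjective _))
        (subsingleton_ext_quotSMulTop hx hn) (add_comm n 1 ▸ hcoker)
    | exact M₁ M₂ M₃ f g hf hg hfg h₁ h₃ =>
      exact subsingleton_ext_X₂ (ModuleCat.shortComplex_shortExact
        (ModuleCat.shortComplexOfCompEqZero f g hfg.linearMap_comp_eq_zero) hfg hf hg)
        (h₁ (f.annihilator_le_of_injective hf hM)) (h₃ (g.annihilator_le_of_surjective hg hM))

theorem bijective_mk₀_comp_extClass_smulShortComplex (hx : IsSMulRegular N x)
    {M : ModuleCat.{u} R} (hM : x ∈ Module.annihilator R M) :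
    Function.Bijective fun f : M ⟶ (N.smulShortComplex x).X₃ =>
      (Ext.mk₀ f).comp hx.smulShortComplex_shortExact.extClass (zero_add 1) := by
  have hsub : Subsingleton (M ⟶ N) := subsingleton_of_forall_eq 0 fun h => by
    ext m
    apply hx
    change x • h.hom m = x • 0
    rw [← map_smul, Module.mem_annihilator.1 hM, map_zero, smul_zero]
  have hxM : x • 𝟙 M = 0 := by
    ext m
    exact Module.mem_annihilator.1 hM m
  have hxe (e : Ext M N 1) : e.comp (Ext.mk₀ (x • 𝟙 N)) (add_zero 1) = 0 := by
    rw [← Ext.smul_eq_comp_mk₀, ← Ext.mk₀_id_comp e, ← Ext.smul_comp, ← Ext.mk₀_smul, hxM,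
      Ext.mk₀_zero, Ext.zero_comp]
  exact bijective_mk₀_comp_extClass _ hsub hxe

theorem exists_comp_eq_of_subsingleton_ext_two (hx : IsSMulRegular N x)
    {S : ShortComplex (ModuleCat.{u} R)} (hS : S.ShortExact)
    (hM : x ∈ Module.annihilator R S.X₂) (h₃ : Subsingleton (Ext S.X₃ N 2))
    (f : S.X₁ ⟶ (N.smulShortComplex x).X₃) :
    ∃ g : S.X₂ ⟶ (N.smulShortComplex x).X₃, S.f ≫ g = f := by
  -- `Hom(-, N ⧸ xN)` is `Ext¹(-, N)` on modules killed by `x`, so the obstruction is in `Ext²`.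
  obtain ⟨e, he⟩ := Ext.contravariant_sequence_exact₁ hS N
    ((Ext.mk₀ f).comp hx.smulShortComplex_shortExact.extClass (zero_add 1)) (one_add_one_eq_two)
    (Subsingleton.elim _ _)
  obtain ⟨g, rfl⟩ := (bijective_mk₀_comp_extClass_smulShortComplex hx hM).surjective e
  have hM₁ := S.f.hom.annihilator_le_of_injective hS.moduleCat_injective_f hM
  refine ⟨g, (bijective_mk₀_comp_extClass_smulShortComplex hx hM₁).injective ?_⟩
  exact (Ext.mk₀_comp_mk₀_assoc ..).symm.trans he

theorem exists_comp_subtype_eq_of_mem_annihilator [IsNoetherianRing R] [Ring.KrullDimLE 1 R]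
    (d : ℕ) [HasInjectiveDimensionLT N d] (hx : IsRegular x) (hxN : IsSMulRegular N x)
    {M : Type u} [AddCommGroup M] [Module R M] [Module.Finite R M]
    (hM : x ∈ Module.annihilator R M) (P : Submodule R M) (f : P →ₗ[R] QuotSMulTop x N) :
    ∃ g : M →ₗ[R] QuotSMulTop x N, g ∘ₗ P.subtype = f := by
  have hP : Function.Exact P.subtype P.mkQ := LinearMap.exact_subtype_mkQ P
  have hS := ModuleCat.shortComplex_shortExact
    (ModuleCat.shortComplexOfCompEqZero _ _ hP.linearMap_comp_eq_zero)
    hP (Submodule.injective_subtype P) (Submodule.mkQ_surjective P)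
  have hExt : Subsingleton (Ext (ModuleCat.of R (M ⧸ P)) N 2) :=
    subsingleton_ext_of_mem_annihilator d hx le_rfl _
      (LinearMap.annihilator_le_of_surjective _ (Submodule.mkQ_surjective P) hM)
  obtain ⟨g, hg⟩ := exists_comp_eq_of_subsingleton_ext_two hxN hS hM hExt (ModuleCat.ofHom f)
  exact ⟨g.hom, congrArg ModuleCat.Hom.hom hg⟩

theorem exists_linearMap_quotSMulTop_apply_ne_zero [IsNoetherianRing R] [Ring.KrullDimLE 1 R]
    (d : ℕ) [HasInjectiveDimensionLT (ModuleCat.of R R) d] (hx : IsRegular x)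
    {M : Type u} [AddCommGroup M] [Module R M] [Module.Finite R M]
    (hM : x ∈ Module.annihilator R M) {m : M} (hm : m ≠ 0) :
    ∃ f : M →ₗ[R] QuotSMulTop x R, f m ≠ 0 := by
  obtain ⟨𝔪, h𝔪, hle⟩ := (Ideal.torsionOf R M m).exists_le_maximal
    fun h => hm (by simpa using h)
  obtain ⟨φ, hφ⟩ := exists_injective_quotient_quotSMulTop hx (hle (Module.mem_annihilator.1 hM m))
  let e := Ideal.quotTorsionOfEquivSpanSingleton R M m
  let m' : R ∙ m := ⟨m, Submodule.mem_span_singleton_self m⟩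
  have hm' : e.symm m' = Submodule.Quotient.mk 1 := by
    rw [LinearEquiv.symm_apply_eq, Ideal.quotTorsionOfEquivSpanSingleton_apply_mk, one_smul]
  obtain ⟨g, hg⟩ := exists_comp_subtype_eq_of_mem_annihilator (N := ModuleCat.of R R) d hx hx.left
    hM (R ∙ m) (φ ∘ₗ Submodule.factor hle ∘ₗ e.symm.toLinearMap)
  have hgm : g m = φ (Submodule.factor hle (e.symm m')) := LinearMap.congr_fun hg m'
  refine ⟨g, fun h => h𝔪.ne_top ((Ideal.eq_top_iff_one _).2 ?_)⟩
  rw [hgm, hm', map_eq_zero_iff φ hφ] at h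
  exact (Submodule.Quotient.mk_eq_zero _).1 h

theorem span_singleton_colon_colon [IsNoetherianRing R] [Ring.KrullDimLE 1 R] (d : ℕ)
    [HasInjectiveDimensionLT (ModuleCat.of R R) d] (hx : IsRegular x) {J : Ideal R} (hxJ : x ∈ J) :
    (Ideal.span {x}).colon ((Ideal.span {x}).colon (J : Set R) : Set R) = J := by
  have hmk (r : R) : (Submodule.Quotient.mk r : QuotSMulTop x R) = 0 ↔ r ∈ Ideal.span {x} := by
    rw [Submodule.Quotient.mk_eq_zero, smul_top_eq_span_singleton]
  refine le_antisymm (fun s hs => by_contra fun hsJ => ?_) fun s hs =>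
    Submodule.mem_colon.2 fun t ht => by
      rw [smul_eq_mul, mul_comm]
      exact Submodule.mem_colon.1 ht s hs
  obtain ⟨f, hf⟩ := exists_linearMap_quotSMulTop_apply_ne_zero d hx (M := R ⧸ J)
    (by rwa [Ideal.annihilator_quotient]) (m := Submodule.Quotient.mk s)
    (by rwa [Ne, Submodule.Quotient.mk_eq_zero])
  obtain ⟨t, ht⟩ := Submodule.mkQ_surjective _ (f (Submodule.Quotient.mk 1))
  have hft (r : R) : f (Submodule.Quotient.mk r) = Submodule.Quotient.mk (r * t) := by
    have hr : (Submodule.Quotient.mk r : R ⧸ J) = r • Submodule.Quotient.mk 1 := by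
      rw [← Submodule.Quotient.mk_smul, smul_eq_mul, mul_one]
    rw [hr, map_smul, ← ht]
    rfl
  refine hf ((hft s).trans ((hmk _).2 (Submodule.mem_colon.1 hs t ?_)))
  refine Submodule.mem_colon.2 fun j hj => ?_
  rw [smul_eq_mul, mul_comm, ← hmk, ← hft, (Submodule.Quotient.mk_eq_zero J).2 hj, map_zero]

end Duality

section SpanPair

variable {R : Type u} [CommRing R] {a b : R}

/-- The presentation of the ideal `(a, b)` by its two generators. -/
def spanPairMap (a b : R) : R × R →ₗ[R] Ideal.span {a, b} :=
  ((LinearMap.toSpanSingleton R R a).coprod (LinearMap.toSpanSingleton R R b)).codRestrict _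
    fun w => Ideal.mem_span_pair.2 ⟨w.1, w.2, rfl⟩

theorem spanPairMap_surjective : Function.Surjective (spanPairMap a b) := by
  rintro ⟨y, hy⟩
  obtain ⟨u, v, rfl⟩ := Ideal.mem_span_pair.1 hy
  exact ⟨(u, v), rfl⟩

theorem mem_ker_spanPairMap {w : R × R} :
    w ∈ LinearMap.ker (spanPairMap a b) ↔ w.1 * a + w.2 * b = 0 :=
  Subtype.ext_iff

/-- The trivial relation `b · a - a · b = 0` between the generators of `(a, b)`. -/
def koszulRelation (a b : R) : LinearMap.ker (spanPairMap a b) :=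
  ⟨(b, -a), mem_ker_spanPairMap.2 (by ring)⟩

theorem smul_eq_fst_smul_koszulRelation (w : LinearMap.ker (spanPairMap a b)) :
    b • w = w.1.1 • koszulRelation a b := by
  refine Subtype.ext (Prod.ext (mul_comm _ _) ?_)
  change b * w.1.2 = w.1.1 * -a
  linear_combination mem_ker_spanPairMap.1 w.2

theorem mul_apply_eq_fst_mul_apply_koszulRelation {N : Ideal R}
    (φ : LinearMap.ker (spanPairMap a b) →ₗ[R] N) (w : LinearMap.ker (spanPairMap a b)) :
    b * (φ w : R) = w.1.1 * φ (koszulRelation a b) := by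
  have h := congrArg φ (smul_eq_fst_smul_koszulRelation w)
  rw [map_smul, map_smul] at h
  exact congrArg Subtype.val h

theorem mem_colon_singleton_iff_exists_mem_ker {x : R} :
    x ∈ (Ideal.span {b}).colon {a} ↔ ∃ w : LinearMap.ker (spanPairMap a b), w.1.1 = x := by
  rw [Submodule.mem_colon_singleton, smul_eq_mul, Ideal.mem_span_singleton']
  constructor
  · rintro ⟨y, hy⟩
    exact ⟨⟨(x, -y), mem_ker_spanPairMap.2 (by linear_combination -hy)⟩, rfl⟩
  · rintro ⟨w, rfl⟩
    exact ⟨-w.1.2, by linear_combination -mem_ker_spanPairMap.1 w.2⟩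

theorem exists_apply_koszulRelation_eq_iff (hb : IsRegular b) {N : Ideal R} {c : R} :
    (∃ φ : LinearMap.ker (spanPairMap a b) →ₗ[R] N, (φ (koszulRelation a b) : R) = c) ↔
      c ∈ (Ideal.span {b} * N).colon ((Ideal.span {b}).colon {a} : Set R) := by
  rw [Submodule.mem_colon]
  constructor
  · rintro ⟨φ, rfl⟩ x hx
    obtain ⟨w, rfl⟩ := mem_colon_singleton_iff_exists_mem_ker.1 hx
    rw [smul_eq_mul, mul_comm (φ _ : R), ← mul_apply_eq_fst_mul_apply_koszulRelation]
    exact Ideal.mul_mem_mul (Ideal.mem_span_singleton_self b) (φ w).2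
  · intro hc
    have hdiv (w : LinearMap.ker (spanPairMap a b)) : ∃ z : N, b * (z : R) = w.1.1 * c := by
      obtain ⟨z, hz, hzw⟩ := Ideal.mem_span_singleton_mul.1
        (hc w.1.1 (mem_colon_singleton_iff_exists_mem_ker.2 ⟨w, rfl⟩))
      exact ⟨⟨z, hz⟩, by rw [hzw, smul_eq_mul, mul_comm]⟩
    choose φ hφ using hdiv
    let φ' : LinearMap.ker (spanPairMap a b) →ₗ[R] N :=
      { toFun := φ
        map_add' w w' := Subtype.ext <| hb.left <| by
          change b * (φ (w + w') : R) = b * (φ w + φ w')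
          rw [mul_add, hφ, hφ, hφ]
          exact add_mul ..
        map_smul' r w := Subtype.ext <| hb.left <| by
          change b * (φ (r • w) : R) = b * (r * φ w)
          rw [mul_left_comm, hφ, hφ]
          exact mul_assoc .. }
    exact ⟨φ', hb.left (hφ _)⟩

theorem exists_comp_subtype_eq_iff (hb : IsRegular b) {N : Ideal R}
    (φ : LinearMap.ker (spanPairMap a b) →ₗ[R] N) :
    (∃ ψ : R × R →ₗ[R] N, ψ ∘ₗ (LinearMap.ker (spanPairMap a b)).subtype = φ) ↔
      (φ (koszulRelation a b) : R) ∈ Ideal.span {a, b} * N := by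
  have hmem (c : R) : c ∈ Ideal.span {a, b} * N ↔
      ∃ y, (∃ q ∈ N, a * q = y) ∧ ∃ z, (∃ p ∈ N, b * p = z) ∧ y + z = c := by
    simp only [Ideal.span_insert, Ideal.sup_mul, Submodule.mem_sup, Ideal.mem_span_singleton_mul]
  constructor
  · rintro ⟨ψ, rfl⟩
    refine (hmem _).2 ⟨_, ⟨ψ (0, -1), (ψ (0, -1)).2, rfl⟩, _, ⟨ψ (1, 0), (ψ (1, 0)).2, rfl⟩, ?_⟩
    have hba : ((b, -a) : R × R) = a • (0, -1) + b • (1, 0) := by simp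
    change _ = (ψ (b, -a) : R)
    rw [hba, map_add, map_smul, map_smul]
    rfl
  · intro h
    obtain ⟨_, ⟨q, hq, rfl⟩, _, ⟨p, hp, rfl⟩, hpq⟩ := (hmem _).1 h
    refine ⟨(LinearMap.toSpanSingleton R N ⟨p, hp⟩).coprod
      (LinearMap.toSpanSingleton R N ⟨-q, neg_mem hq⟩), LinearMap.ext fun w =>
        Subtype.ext (hb.left ?_)⟩
    change b * (w.1.1 * p + w.1.2 * -q) = b * (φ w : R)
    rw [mul_apply_eq_fst_mul_apply_koszulRelation, ← hpq]
    linear_combination -q * mem_ker_spanPairMap.1 w.2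

theorem subsingleton_ext_span_pair_iff (hb : IsRegular b) (N : Ideal R) :
    Subsingleton (Ext (ModuleCat.of R (Ideal.span {a, b})) (ModuleCat.of R N) 1) ↔
      (Ideal.span {b} * N).colon ((Ideal.span {b}).colon {a} : Set R) ≤
        Ideal.span {a, b} * N := by
  have : Projective (spanPairMap a b).shortComplexKer.X₂ :=
    inferInstanceAs (Projective (ModuleCat.of R (R × R)))
  have hExt : Subsingleton (Ext (ModuleCat.of R (Ideal.span {a, b})) (ModuleCat.of R N) 1) ↔
      ∀ φ : LinearMap.ker (spanPairMap a b) →ₗ[R] N,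
        ∃ ψ : R × R →ₗ[R] N, ψ ∘ₗ (LinearMap.ker (spanPairMap a b)).subtype = φ := by
    refine (subsingleton_ext_one_iff_forall_exists_comp_eq (Y := ModuleCat.of R N)
      (LinearMap.shortExact_shortComplexKer spanPairMap_surjective)).trans
      ⟨fun h φ => ?_, fun h f => ?_⟩
    · obtain ⟨g, hg⟩ := h (ModuleCat.ofHom φ)
      exact ⟨g.hom, congrArg ModuleCat.Hom.hom hg⟩
    · obtain ⟨ψ, hψ⟩ := h f.hom
      exact ⟨ModuleCat.ofHom ψ, ModuleCat.hom_ext hψ⟩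
  simp only [hExt, exists_comp_subtype_eq_iff hb, SetLike.le_def,
    ← exists_apply_koszulRelation_eq_iff hb, forall_exists_index, forall_apply_eq_imp_iff]

end SpanPair

section Colon

variable {R : Type u} [CommRing R] {a b x y : R}

theorem span_singleton_mul_injective (ha : IsRegular a) :
    Function.Injective fun J : Ideal R => Ideal.span {a} * J := by
  have hmem (L : Ideal R) (r : R) : a * r ∈ Ideal.span {a} * L ↔ r ∈ L := by
    rw [Ideal.mem_span_singleton_mul]
    exact ⟨fun ⟨z, hz, hzr⟩ => ha.left hzr ▸ hz, fun hr => ⟨r, hr, rfl⟩⟩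
  intro J K (hJK : Ideal.span {a} * J = Ideal.span {a} * K)
  ext r
  rw [← hmem J, hJK, hmem]

theorem span_singleton_mul_inf (ha : IsRegular a) (J K : Ideal R) :
    Ideal.span {a} * (J ⊓ K) = Ideal.span {a} * J ⊓ Ideal.span {a} * K := by
  refine le_antisymm (le_inf (Ideal.mul_mono_right inf_le_left)
    (Ideal.mul_mono_right inf_le_right)) fun r ⟨hJ, hK⟩ => ?_
  obtain ⟨s, hs, rfl⟩ := Ideal.mem_span_singleton_mul.1 hJ
  obtain ⟨t, ht, hts⟩ := Ideal.mem_span_singleton_mul.1 hK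
  exact Ideal.mem_span_singleton_mul.2 ⟨s, ⟨hs, ha.left hts ▸ ht⟩, rfl⟩

theorem span_singleton_mul_colon_singleton (N : Ideal R) (a : R) :
    Ideal.span {a} * N.colon {a} = N ⊓ Ideal.span {a} := by
  ext r
  rw [Ideal.mem_span_singleton_mul, Submodule.mem_inf, Ideal.mem_span_singleton']
  constructor
  · rintro ⟨s, hs, rfl⟩
    exact ⟨mul_comm a s ▸ Submodule.mem_colon_singleton.1 hs, s, mul_comm s a⟩
  · rintro ⟨hr, s, rfl⟩
    exact ⟨s, Submodule.mem_colon_singleton.2 hr, mul_comm a s⟩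

theorem span_singleton_mul_colon_comm (a b : R) :
    Ideal.span {a} * (Ideal.span {b}).colon {a} = Ideal.span {b} * (Ideal.span {a}).colon {b} := by
  rw [span_singleton_mul_colon_singleton, span_singleton_mul_colon_singleton, inf_comm]

theorem span_singleton_mul_colon_self (hb : IsRegular b) (K : Ideal R) :
    (Ideal.span {b} * K).colon {b} = K := by
  refine span_singleton_mul_injective hb ?_
  change Ideal.span {b} * (Ideal.span {b} * K).colon {b} = Ideal.span {b} * K
  rw [span_singleton_mul_colon_singleton, inf_eq_left]
  exact Ideal.mul_le_left

theorem le_colon_iff_mul_le {N J P : Ideal R} : P ≤ N.colon (J : Set R) ↔ P * J ≤ N := by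
  rw [Ideal.mul_le]
  exact forall₂_congr fun _ _ => Submodule.mem_colon

theorem colon_mul (N J K : Ideal R) :
    N.colon ((J * K : Ideal R) : Set R) = (N.colon (J : Set R)).colon (K : Set R) :=
  eq_of_forall_le_iff fun P => by
    rw [le_colon_iff_mul_le, le_colon_iff_mul_le, le_colon_iff_mul_le, mul_comm J, mul_assoc]

theorem colon_span_pair (N : Ideal R) (a b : R) :
    N.colon (Ideal.span {a, b} : Set R) = N.colon {a} ⊓ N.colon {b} := by
  rw [Ideal.colon_span (I := N), Set.insert_eq, Submodule.colon_union]

theorem span_singleton_colon_span_pair (a b : R) :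
    (Ideal.span {b}).colon (Ideal.span {a, b} : Set R) = (Ideal.span {b}).colon {a} := by
  have htop : (Ideal.span {b}).colon {b} = ⊤ :=
    (Submodule.colon_eq_top_iff_subset _).2
      (Set.singleton_subset_iff.2 (Ideal.mem_span_singleton_self b))
  rw [colon_span_pair, htop, inf_top_eq]

theorem colon_eq_span_singleton_mul_colon_of_mem (hx : IsRegular x) (hy : IsRegular y) {J : Ideal R}
    (hyJ : y ∈ J) : (Ideal.span {x * y}).colon (J : Set R) =
      Ideal.span {x} * (Ideal.span {y}).colon (J : Set R) := by
  ext r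
  simp only [Ideal.mem_span_singleton_mul, Submodule.mem_colon, SetLike.mem_coe, smul_eq_mul,
    Ideal.mem_span_singleton]
  constructor
  · intro hr
    obtain ⟨s, hs⟩ := hr y hyJ
    obtain rfl : r = x * s := hy.right (by linear_combination hs)
    refine ⟨s, fun j hj => ?_, rfl⟩
    obtain ⟨t, ht⟩ := hr j hj
    exact ⟨t, hx.left (by linear_combination ht)⟩
  · rintro ⟨s, hs, rfl⟩ j hj
    rw [mul_assoc]
    exact mul_dvd_mul_left x (hs j hj)

end Colon

section Rigidity

variable {R : Type u} [CommRing R] {a b : R}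

theorem span_singleton_mul_colon_span_pair_sq (ha : IsRegular a) (hb : IsRegular b) :
    Ideal.span {a} * (Ideal.span {b * b}).colon (Ideal.span {a, b} * Ideal.span {a, b} : Ideal R) =
      Ideal.span {b} * ((Ideal.span {a}).colon {b} ⊓ (Ideal.span {b}).colon {a}) := by
  set L := (Ideal.span {a}).colon {b}
  set K := (Ideal.span {b}).colon {a}
  have hbI : b ∈ Ideal.span {a, b} := Ideal.subset_span (Set.mem_insert_of_mem a rfl)
  have haK : Ideal.span {a} * K = Ideal.span {b} * L := span_singleton_mul_colon_comm a b
  calc Ideal.span {a} * (Ideal.span {b * b}).colon (Ideal.span {a, b} * Ideal.span {a, b} : Ideal R)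
      = Ideal.span {a} * ((Ideal.span {b} * K).colon {a} ⊓ K) := by
        rw [colon_mul, colon_eq_span_singleton_mul_colon_of_mem hb hb hbI,
          span_singleton_colon_span_pair, colon_span_pair, span_singleton_mul_colon_self hb]
    _ = Ideal.span {b} * K ⊓ Ideal.span {a} ⊓ Ideal.span {b} * L := by
        rw [span_singleton_mul_inf ha, span_singleton_mul_colon_singleton, haK]
    _ = Ideal.span {b} * (L ⊓ K) := by
        have haL : Ideal.span {b} * L ≤ Ideal.span {a} := haK ▸ Ideal.mul_le_left
        rw [inf_assoc, inf_eq_right.2 haL, inf_comm, span_singleton_mul_inf hb]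

theorem eq_span_singleton_colon_comm [IsNoetherianRing R] [Ring.KrullDimLE 1 R] (d : ℕ)
    [HasInjectiveDimensionLT (ModuleCat.of R R) d] {x : R} (hx : IsRegular x) {A B : Ideal R}
    (hA : x ∈ A) (hB : x ∈ B) :
    A = (Ideal.span {x}).colon (B : Set R) ↔ B = (Ideal.span {x}).colon (A : Set R) := by
  constructor
  · rintro rfl
    exact (span_singleton_colon_colon d hx hB).symm
  · rintro rfl
    exact (span_singleton_colon_colon d hx hA).symm

theorem isRigidModule_span_pair_iff_mul_self_eq_colon [IsNoetherianRing R] [Ring.KrullDimLE 1 R]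
    (d : ℕ) [HasInjectiveDimensionLT (ModuleCat.of R R) d] (hb : IsRegular b) :
    IsRigidModule R (Ideal.span {a, b}) ↔ Ideal.span {a, b} * Ideal.span {a, b} =
      (Ideal.span {b * b}).colon
        ((Ideal.span {b}).colon {a} * (Ideal.span {b}).colon {a} : Ideal R) := by
  set I := Ideal.span {a, b}
  set K := (Ideal.span {b}).colon {a}
  have hbI : b ∈ I := Ideal.subset_span (Set.mem_insert_of_mem a rfl)
  have hbK : b ∈ K := Ideal.le_colon (Ideal.mem_span_singleton_self b)
  have hKI : K = (Ideal.span {b}).colon (I : Set R) := (span_singleton_colon_span_pair a b).symm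
  have hIK : I = (Ideal.span {b}).colon (K : Set R) :=
    (eq_span_singleton_colon_comm d hb hbI hbK).2 hKI
  have hcolon : (Ideal.span {b * b}).colon ((K * K : Ideal R) : Set R) =
      (Ideal.span {b} * I).colon (K : Set R) := by
    rw [colon_mul, colon_eq_span_singleton_mul_colon_of_mem hb hb hbK, ← hIK]
  have hle : I * I ≤ (Ideal.span {b} * I).colon (K : Set R) := by
    rw [le_colon_iff_mul_le, mul_right_comm]
    exact Ideal.mul_mono_left (le_colon_iff_mul_le.1 hIK.le)
  rw [hcolon, ← hle.ge_iff_eq]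
  exact subsingleton_ext_span_pair_iff hb I

end Rigidity

theorem corollary4p9_general {R : Type u} [CommRing R] [IsNoetherianRing R] [Ring.KrullDimLE 1 R]
    (d : ℕ) [HasInjectiveDimensionLT (ModuleCat.of R R) d] {a b : R} (ha : IsRegular a)
    (hb : IsRegular b) :
    IsRigidModule R (Ideal.span {a, b}) ↔
      (Ideal.span {a}).colon {b} ⊓ (Ideal.span {b}).colon {a} =
        (Ideal.span {a}).colon {b} * (Ideal.span {b}).colon {a} := by
  have hI := span_singleton_mul_colon_span_pair_sq ha hb
  have hK := span_singleton_mul_colon_comm a b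
  rw [isRigidModule_span_pair_iff_mul_self_eq_colon d hb]
  set I := Ideal.span {a, b}
  set L := (Ideal.span {a}).colon {b}
  set K := (Ideal.span {b}).colon {a}
  have hbI : b ∈ I := Ideal.subset_span (Set.mem_insert_of_mem a rfl)
  have hbK : b ∈ K := Ideal.le_colon (Ideal.mem_span_singleton_self b)
  calc I * I = (Ideal.span {b * b}).colon ((K * K : Ideal R) : Set R)
      ↔ K * K = (Ideal.span {b * b}).colon ((I * I : Ideal R) : Set R) :=
        eq_span_singleton_colon_comm d (hb.mul hb) (Ideal.mul_mem_mul hbI hbI)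
          (Ideal.mul_mem_mul hbK hbK)
    _ ↔ Ideal.span {b} * (L * K) = Ideal.span {b} * (L ⊓ K) := by
        rw [← hI, ← mul_assoc, ← hK, mul_assoc]
        exact (span_singleton_mul_injective ha).eq_iff.symm
    _ ↔ L ⊓ K = L * K := (span_singleton_mul_injective hb).eq_iff.trans eq_comm

theorem corollary4p9 {R : Type u} [CommRing R] [IsGorensteinLocalRing R]
    (hdim : ringKrullDim R = 1) (a b : R) (ha : IsRegular a) (hb : IsRegular b)
    (I : Ideal R) (hI : I = Ideal.span {a, b}) :
    IsRigidModule R I ↔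
      (Ideal.span {a}).colon {b} ⊓ (Ideal.span {b}).colon {a} =
        (Ideal.span {a}).colon {b} * (Ideal.span {b}).colon {a} := by
  subst hI
  obtain ⟨d, _⟩ := IsGorensteinLocalRing.exists_hasInjectiveDimensionLE (R := R)
  have : Ring.KrullDimLE 1 R := Ring.krullDimLE_iff.2 hdim.le
  exact corollary4p9_general (d + 1) ha hb
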